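/- Let $n\ge 1$ and let a finite group $G$ act on the algebra $A=M_n(\mathbb{C})$ by $*$-automorphisms, i.e. through a homomorphism $G\to \mathrm{Aut}(A)=PU(n)$. Let $\widetilde G=G\times_{PU(n)}SU(n)$ be the pull-back of $SU(n)\to PU(n)$ along this homomorphism; it is a central extension of $G$ by the group $\mu_n$ of $n$-th roots of unity, with projection $\pi:\widetilde G\to G$. Let $G\ltimes A$ be the semi-direct (crossed) product algebra, consisting of the sums $\sum_{g\in G}a_g\,g$ with $a_g\in A$ and $(a\,g)(b\,h)=a\,(g\cdot b)\,gh$. For a ring $R$ let $K(R)$ be the Grothendieck group of finitely generated projective left $R$-modules, and let $K_G(A)$ be the Grothendieck group of the category of finitely generated projective left $A$-modules $E$ with a left action of $G$ by additive maps such that $g(ae)=(g\cdot a)(ge)$ (this is the twisted equivariant $K$-group $K_G^{(A)}(X)$ for $X$ a point). Then: 1. $K_G(A)\cong K(G\ltimes A)$, by the isomorphism sending the class of $E$ to the class of $E$ regarded as a $G\ltimes A$-module. 2. $K(G\ltimes A)$ is a free abelian group of finite rank, and its rank is the number of conjugacy classes $C$ of $G$ that split into $n$ conjugacy classes in $\widetilde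 G$, i.e. such that $\pi^{-1}(C)$ is the union of exactly $n$ conjugacy classes of $\widetilde G$. 3. The $\mathbb{C}$-vector space of functions of linear type on $\widetilde G$, i.e. of functions $f:\widetilde G\to\mathbb{C}$ with $f(hxh^{-1})=f(x)$ for all $h,x\in\widetilde G$ and $f(\lambda x)=\lambda f(x)$ for all $\lambda\in\mu_n$, $x\in\widetilde G$, is isomorphic to the space of complex functions on the set of conjugacy classes of $G$ that split into $n$ conjugacy classes in $\widetilde G$; in particular its dimension equals the rank in 2. -/

import Mathlib

universe u v

/-! ### The Grothendieck group `K(R)` of finitely generated projective left modules -/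

/-- An object of `𝒫(R)`: a finitely generated projective left `R`-module. -/
structure ProjMod (R : Type u) [Ring R] where
  carrier : Type u
  [addCommGroup : AddCommGroup carrier]
  [module : Module R carrier]
  [finite : Module.Finite R carrier]
  [projective : Module.Projective R carrier]

attribute [instance] ProjMod.addCommGroup ProjMod.module ProjMod.finite ProjMod.projective

namespace ProjMod

variable (R : Type u) [Ring R]

/-- Two objects are identified when they are isomorphic as `R`-modules. -/
instance isoSetoid : Setoid (ProjMod R) where
  r M N := Nonempty (M.carrier ≃ₗ[R] N.carrier)
  iseqv :=
    { refl := fun _ => ⟨LinearEquiv.refl R _⟩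
      symm := fun ⟨e⟩ => ⟨e.symm⟩
      trans := fun ⟨e⟩ ⟨f⟩ => ⟨e.trans f⟩ }

/-- Isomorphism classes of finitely generated projective `R`-modules. -/
def IsoClass : Type (u + 1) := Quotient (isoSetoid R)

variable {R}

/-- The isomorphism class of a module. -/
def toIsoClass (M : ProjMod R) : IsoClass R := Quotient.mk _ M

/-- The direct sum. -/
def dsum (M N : ProjMod R) : ProjMod R where
  carrier := M.carrier × N.carrier

/-- The zero module. -/
def zeroMod : ProjMod R where
  carrier := PUnit.{u + 1}

instance : Zero (IsoClass R) := ⟨toIsoClass zeroMod⟩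

instance : Add (IsoClass R) :=
  ⟨Quotient.map₂ dsum fun _ _ ⟨e⟩ _ _ ⟨f⟩ => ⟨LinearEquiv.prodCongr e f⟩⟩

/-- Isomorphism classes form a commutative monoid under direct sum. -/
instance : AddCommMonoid (IsoClass R) where
  add_assoc := by
    rintro ⟨M⟩ ⟨N⟩ ⟨P⟩
    exact Quotient.sound ⟨LinearEquiv.prodAssoc R _ _ _⟩
  zero_add := by
    rintro ⟨M⟩
    exact Quotient.sound
      ⟨(LinearEquiv.uniqueProd : (PUnit.{u + 1} × M.carrier) ≃ₗ[R] M.carrier)⟩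
  add_zero := by
    rintro ⟨M⟩
    exact Quotient.sound
      ⟨(LinearEquiv.prodUnique : (M.carrier × PUnit.{u + 1}) ≃ₗ[R] M.carrier)⟩
  add_comm := by
    rintro ⟨M⟩ ⟨N⟩
    exact Quotient.sound ⟨LinearEquiv.prodComm R _ _⟩
  nsmul := nsmulRec

end ProjMod

/-- `K(R) = K₀(R)`: the Grothendieck group of the category of finitely generated projective
left `R`-modules. -/
abbrev KGroup (R : Type u) [Ring R] : Type (u + 1) :=
  Algebra.GrothendieckAddGroup (ProjMod.IsoClass R)

/-- The class `[M] ∈ K(R)`. -/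
def ProjMod.toK {R : Type u} [Ring R] (M : ProjMod R) : KGroup R :=
  Algebra.GrothendieckAddGroup.of M.toIsoClass

/-! ### The equivariant Grothendieck group `K_G(A)` (for a discrete group `G`) -/

/-- An object of `𝒫_G(A)`: a finitely generated projective left `A`-module `E` with a left action
of `G` by additive maps such that `g • (a • e) = (g • a) • (g • e)`. -/
structure EquivProjMod (G : Type u) (A : Type v) [Group G] [Ring A] [MulSemiringAction G A] where
  carrier : Type (max u v)
  [addCommGroup : AddCommGroup carrier]
  [module : Module A carrier]
  [action : DistribMulAction G carrier]
  [finite : Module.Finite A carrier]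
  [projective : Module.Projective A carrier]
  smul_smul' : ∀ (g : G) (a : A) (e : carrier), g • (a • e) = (g • a) • (g • e)

attribute [instance] EquivProjMod.addCommGroup EquivProjMod.module EquivProjMod.action
  EquivProjMod.finite EquivProjMod.projective

namespace EquivProjMod

variable (G : Type u) (A : Type v) [Group G] [Ring A] [MulSemiringAction G A]

/-- Two objects are identified when there is a `G`-equivariant `A`-linear isomorphism. -/
instance isoSetoid : Setoid (EquivProjMod G A) where
  r E F := ∃ φ : E.carrier ≃ₗ[A] F.carrier, ∀ (g : G) (e : E.carrier), φ (g • e) = g • φ e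
  iseqv :=
    { refl := fun _ => ⟨LinearEquiv.refl A _, fun _ _ => rfl⟩
      symm := by
        rintro E F ⟨φ, h⟩
        exact ⟨φ.symm, fun g e => φ.injective (by simp [h])⟩
      trans := by
        rintro E F H ⟨φ, h⟩ ⟨ψ, k⟩
        exact ⟨φ.trans ψ, fun g e => by simp [h, k]⟩ }

/-- Isomorphism classes of objects of `𝒫_G(A)`. -/
def IsoClass : Type (max u v + 1) := Quotient (isoSetoid G A)

variable {G A}

/-- The isomorphism class of an object. -/
def toIsoClass (E : EquivProjMod G A) : IsoClass G A := Quotient.mk _ E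

/-- The direct sum, with `G` acting componentwise. -/
def dsum (E F : EquivProjMod G A) : EquivProjMod G A where
  carrier := E.carrier × F.carrier
  smul_smul' g a e := Prod.ext (E.smul_smul' g a e.1) (F.smul_smul' g a e.2)

/-- The zero object. -/
def zeroMod : EquivProjMod G A where
  carrier := PUnit.{max u v + 1}
  action :=
    { smul := fun _ x => x
      one_smul := fun _ => rfl
      mul_smul := fun _ _ _ => rfl
      smul_zero := fun _ => rfl
      smul_add := fun _ _ _ => rfl }
  smul_smul' _ _ _ := rfl

instance : Zero (IsoClass G A) := ⟨toIsoClass zeroMod⟩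

instance : Add (IsoClass G A) :=
  ⟨Quotient.map₂ dsum fun _ _ ⟨φ, h⟩ _ _ ⟨ψ, k⟩ =>
    ⟨LinearEquiv.prodCongr φ ψ, fun g e => Prod.ext (h g e.1) (k g e.2)⟩⟩

/-- Isomorphism classes form a commutative monoid under direct sum. -/
instance : AddCommMonoid (IsoClass G A) where
  add_assoc := by
    rintro ⟨E⟩ ⟨F⟩ ⟨H⟩
    exact Quotient.sound ⟨LinearEquiv.prodAssoc A _ _ _, fun _ _ => rfl⟩
  zero_add := by
    rintro ⟨E⟩
    exact Quotient.sound
      ⟨(LinearEquiv.uniqueProd : (PUnit.{max u v + 1} × E.carrier) ≃ₗ[A] E.carrier),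
        fun _ _ => rfl⟩
  add_zero := by
    rintro ⟨E⟩
    exact Quotient.sound
      ⟨(LinearEquiv.prodUnique : (E.carrier × PUnit.{max u v + 1}) ≃ₗ[A] E.carrier),
        fun _ _ => rfl⟩
  add_comm := by
    rintro ⟨E⟩ ⟨F⟩
    exact Quotient.sound ⟨LinearEquiv.prodComm A _ _, fun _ _ => rfl⟩
  nsmul := nsmulRec

end EquivProjMod

/-- `K_G(A)`: the Grothendieck group of the category `𝒫_G(A)`. -/
abbrev EquivKGroup (G : Type u) (A : Type v) [Group G] [Ring A] [MulSemiringAction G A] :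
    Type (max u v + 1) :=
  Algebra.GrothendieckAddGroup (EquivProjMod.IsoClass G A)

/-- The class `[E] ∈ K_G(A)`. -/
def EquivProjMod.toK {G : Type u} {A : Type v} [Group G] [Ring A] [MulSemiringAction G A]
    (E : EquivProjMod G A) : EquivKGroup G A :=
  Algebra.GrothendieckAddGroup.of E.toIsoClass

/-- The semi-direct (crossed) product `G ⋉ A`: finite sums `∑ a_g g` with
`(a g) (b h) = (a (g • b)) (g h)`. -/
abbrev CrossedProduct (G : Type u) (A : Type v) [Group G] [Ring A] [MulSemiringAction G A] :
    Type (max u v) :=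
  SkewMonoidAlgebra A G

/-- The `G ⋉ A`-module `M` and the `G`-equivariant `A`-module `E` have the same underlying additive
group, `A` and `G` acting on `E` through their images in `G ⋉ A`. -/
def SameModule {G : Type u} {A : Type v} [Group G] [Ring A] [MulSemiringAction G A]
    (E : EquivProjMod G A) (M : ProjMod (CrossedProduct G A)) : Prop :=
  ∃ φ : E.carrier ≃+ M.carrier,
    (∀ (a : A) (e : E.carrier),
      φ (a • e) = (SkewMonoidAlgebra.single (1 : G) a : CrossedProduct G A) • φ e) ∧
    (∀ (g : G) (e : E.carrier),
      φ (g • e) = (SkewMonoidAlgebra.single g (1 : A) : CrossedProduct G A) • φ e)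

/-! ### The central extension and functions of linear type -/

/-- The algebra `M_n(ℂ)`. -/
abbrev MatC (n : ℕ) : Type := Matrix (Fin n) (Fin n) ℂ

/-- For `G` acting on `M_n(ℂ)` by `*`-automorphisms, i.e. through
`G → Aut(M_n(ℂ)) = PU(n)`, this is the pull-back of `SU(n) → PU(n)` along `G → PU(n)`:
the group of pairs `(g, s)` with `s ∈ SU(n)` such that `g` acts as conjugation by `s`. -/
def TildeGroup (G : Type u) (n : ℕ) [Group G] [MulSemiringAction G (MatC n)] :
    Subgroup (G × Matrix.specialUnitaryGroup (Fin n) ℂ) where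
  carrier := {p | ∀ a : MatC n, p.1 • a = (p.2 : MatC n) * a * ((p.2⁻¹ :
    Matrix.specialUnitaryGroup (Fin n) ℂ) : MatC n)}
  one_mem' a := by simp
  mul_mem' {p q} hp hq a := by
    simp only [Prod.fst_mul, Prod.snd_mul, mul_smul, mul_inv_rev, Submonoid.coe_mul]
    rw [hq a, hp]
    simp only [mul_assoc]
  inv_mem' {p} hp a := by
    have h1 : ((p.2⁻¹ : Matrix.specialUnitaryGroup (Fin n) ℂ) : MatC n) * (p.2 : MatC n) = 1 := by
      rw [← Submonoid.coe_mul, inv_mul_cancel, Submonoid.coe_one]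
    have h2 : (p.2 : MatC n) * ((p.2⁻¹ : Matrix.specialUnitaryGroup (Fin n) ℂ) : MatC n) = 1 := by
      rw [← Submonoid.coe_mul, mul_inv_cancel, Submonoid.coe_one]
    simp only [Prod.fst_inv, Prod.snd_inv, inv_inv]
    rw [inv_smul_eq_iff, hp]
    simp only [mul_assoc, h2, mul_one]
    rw [← mul_assoc, h2, one_mul]

namespace TildeGroup

variable (G : Type u) (n : ℕ) [Group G] [MulSemiringAction G (MatC n)]

/-- The projection `π : G̃ → G`. -/
def proj : TildeGroup G n →* G :=
  (MonoidHom.fst G (Matrix.specialUnitaryGroup (Fin n) ℂ)).comp (TildeGroup G n).subtype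

/-- A scalar matrix `λ` with `λ ^ n = 1`, as an element of `SU(n)`. -/
def scalarSU [NeZero n] (z : rootsOfUnity n ℂ) : Matrix.specialUnitaryGroup (Fin n) ℂ :=
  ⟨Matrix.scalar (Fin n) ((z : ℂˣ) : ℂ), by
    have hz : ((z : ℂˣ) : ℂ) ^ n = 1 := (mem_rootsOfUnity' n _).1 z.2
    have hnorm : ‖((z : ℂˣ) : ℂ)‖ = 1 := Complex.norm_eq_one_of_pow_eq_one hz (NeZero.ne n)
    rw [Matrix.mem_specialUnitaryGroup_iff, Matrix.mem_unitaryGroup_iff]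
    refine ⟨?_, by simp [hz]⟩
    have h : ((z : ℂˣ) : ℂ) * star ((z : ℂˣ) : ℂ) = 1 := by
      have := Complex.mul_conj ((z : ℂˣ) : ℂ)
      simpa [Complex.normSq_eq_norm_sq, hnorm] using this
    rw [Matrix.star_eq_conjTranspose, Matrix.scalar_apply, Matrix.diagonal_conjTranspose,
      Matrix.diagonal_mul_diagonal, ← Matrix.diagonal_one]
    congr 1
    funext i
    exact h⟩

/-- The inclusion of the fibre, `μ_n → G̃`, `λ ↦ (1, λ)`. -/
def ofMu [NeZero n] (z : rootsOfUnity n ℂ) : TildeGroup G n :=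
  ⟨(1, scalarSU n z), fun a => by
    have hc : ((scalarSU n z : Matrix.specialUnitaryGroup (Fin n) ℂ) : MatC n) * a
        = a * ((scalarSU n z : Matrix.specialUnitaryGroup (Fin n) ℂ) : MatC n) :=
      (Matrix.scalar_commute _ (fun _ => Commute.all _ _) a).eq
    rw [one_smul, hc, mul_assoc, ← Submonoid.coe_mul, mul_inv_cancel, Submonoid.coe_one,
      mul_one]⟩

/-- The conjugacy classes of `G` which split into `n` conjugacy classes in `G̃`: those whose
preimage in `G̃` is the union of exactly `n` conjugacy classes. -/
def SplitClass : Type u :=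
  {C : ConjClasses G //
    Nat.card {D : ConjClasses (TildeGroup G n) // ConjClasses.map (proj G n) D = C} = n}

/-- The `ℂ`-vector space of functions of linear type on `G̃`: class functions `f` with
`f (λ x) = λ f x` for every `λ ∈ μ_n`. -/
def LinearTypeFun [NeZero n] : Submodule ℂ (TildeGroup G n → ℂ) where
  carrier := {f | (∀ h x, f (h * x * h⁻¹) = f x) ∧
    ∀ (z : rootsOfUnity n ℂ) (x), f (ofMu G n z * x) = ((z : ℂˣ) : ℂ) * f x}
  zero_mem' := ⟨fun _ _ => rfl, fun _ _ => by simp⟩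
  add_mem' := by
    rintro f f' ⟨h1, h2⟩ ⟨h1', h2'⟩
    exact ⟨fun h x => by simp [h1, h1'], fun z x => by simp [h2, h2', mul_add]⟩
  smul_mem' := by
    rintro c f ⟨h1, h2⟩
    exact ⟨fun h x => by simp [h1], fun z x => by simp [h2, mul_left_comm]⟩

end TildeGroup

/-! Put R = G ⋉ A. An equivariant A-module is the same thing as an R-module, since R is generated by
A and G subject to the relation g a = (g • a) g. Finite generation over A and over R agree because G
is finite, and projectivity is automatic: A is semisimple, and averaging over G makes R semisimple
as well (`CrossedProduct.isSemisimpleRing`).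

Over ℂ, R is then a product of k matrix algebras. A finitely generated module is determined by its
multiplicity in each block, so K(R) is ℤ^k, and k is the dimension of the center of R
(`KGroup.nonempty_addEquiv_pi_int`).

The center is the link with G̃. Each g acts as conjugation by some s in SU(n), so π is surjective,
with kernel μ_n. If ∑ z_g g is central, then z_g s is a scalar matrix for each (g, s) in G̃; its
trace is a function of linear type, and every such function arises once
(`nonempty_center_equiv_linearTypeFun`).

Finally, μ_n permutes transitively the classes of G̃ above a class C of G, so C splits into n
classes exactly when this action is free. Above such a C, a function of linear type is given by one
arbitrary value; above any other class it vanishes, because x is conjugate to λ x for some λ ≠ 1.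
Hence k is the number of splitting classes. -/

/-! ### Grothendieck groups of commutative monoids -/

namespace Algebra.GrothendieckAddGroup

variable {M N : Type*} [AddCommMonoid M] [AddCommMonoid N]

theorem lift_of {H : Type*} [AddCommGroup H] (f : M →+ H) (m : M) : lift f (of m) = f m :=
  DFunLike.congr_fun (lift.symm_apply_apply f) m

theorem hom_ext {H : Type*} [AddCommGroup H] {f g : GrothendieckAddGroup M →+ H}
    (h : ∀ m, f (of m) = g (of m)) : f = g :=
  lift.symm.injective (AddMonoidHom.ext h)

/-- Isomorphic monoids have isomorphic Grothendieck groups. -/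
noncomputable def congr (e : M ≃+ N) : GrothendieckAddGroup M ≃+ GrothendieckAddGroup N :=
  AddMonoidHom.toAddEquiv (lift (of.comp e.toAddMonoidHom)) (lift (of.comp e.symm.toAddMonoidHom))
    (hom_ext fun m => by
      rw [AddMonoidHom.comp_apply, lift_of, AddMonoidHom.comp_apply, lift_of]
      exact congrArg of (e.symm_apply_apply m))
    (hom_ext fun m => by
      rw [AddMonoidHom.comp_apply, lift_of, AddMonoidHom.comp_apply, lift_of]
      exact congrArg of (e.apply_symm_apply m))

theorem congr_of (e : M ≃+ N) (m : M) : congr e (of m) = of (e m)  := by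
  change lift (of.comp e.toAddMonoidHom) (of m) = _
  rw [lift_of]
  rfl

theorem exists_of_sub_of (x : GrothendieckAddGroup M) : ∃ a b : M, x = of a - of b := by
  induction x using AddLocalization.ind with
  | H y =>
    refine ⟨y.1, y.2, ?_⟩
    rw [eq_sub_iff_add_eq, AddLocalization.mk_eq_addMonoidOf_mk']
    exact AddSubmonoid.LocalizationMap.mk'_spec _ _ _

/-- The Grothendieck group of `ℕ^ι` is `ℤ^ι`. -/
noncomputable def piNat (ι : Type*) : GrothendieckAddGroup (ι → ℕ) ≃+ (ι → ℤ) :=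
  AddEquiv.ofBijective (lift (AddMonoidHom.pi fun i =>
      (Nat.castAddMonoidHom ℤ).comp (Pi.evalAddMonoidHom (fun _ : ι => ℕ) i))) <| by
    constructor
    · rw [injective_iff_map_eq_zero]
      intro x hx
      obtain ⟨a, b, rfl⟩ := exists_of_sub_of x
      rw [map_sub, lift_of, lift_of, sub_eq_zero] at hx
      rw [sub_eq_zero]
      congr 1
      funext i
      exact Nat.cast_injective (R := ℤ) (congrFun hx i)
    · intro c
      -- Positive part minus negative part.
      refine ⟨of (fun i => (c i).toNat) - of (fun i => (-c i).toNat), ?_⟩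
      rw [map_sub, lift_of, lift_of]
      funext i
      change ((c i).toNat : ℤ) - ((-c i).toNat : ℤ) = c i
      lia

end Algebra.GrothendieckAddGroup

/-! ### Modules and center of a product of matrix algebras -/

section SplitSemisimple

open Module

variable {F : Type*} [Field F] {R : Type u} [Ring R] [Algebra F R] {ι : Type*}
  [DecidableEq ι] {d : ι → ℕ} (e : R ≃ₐ[F] Π i, Matrix (Fin (d i)) (Fin (d i)) F)

/-- The matrix units of an algebra isomorphic to a product of matrix algebras. -/
def matUnit (i : ι) (a b : Fin (d i)) : R :=
  e.symm (Pi.single i (Matrix.single a b 1))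

theorem matUnit_mul_same (i : ι) (a b c : Fin (d i)) :
    matUnit e i a b * matUnit e i b c = matUnit e i a c := by
  simp [matUnit, ← map_mul, ← Pi.single_mul]

theorem matUnit_mul_of_ne (i : ι) (a b c c' : Fin (d i)) (h : b ≠ c) :
    matUnit e i a b * matUnit e i c c' = 0 := by
  simp [matUnit, ← map_mul, ← Pi.single_mul, h]

theorem matUnit_mul_of_ne_index {i j : ι} (h : i ≠ j) (a b : Fin (d i)) (c c' : Fin (d j)) :
    matUnit e i a b * matUnit e j c c' = 0 := by
  rw [matUnit, matUnit, ← map_mul, map_eq_zero_iff _ e.symm.injective]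
  funext k
  by_cases hk : k = i
  · subst hk
    simp [h]
  · simp [hk]

theorem matUnit_ne_zero (i : ι) (a b : Fin (d i)) : matUnit e i a b ≠ 0 := by
  rw [matUnit, Ne, map_eq_zero_iff _ e.symm.injective]
  intro h
  simpa using congrFun (congrFun (congrFun h i) a) b

theorem matUnit_mul_mul (i : ι) (a b : Fin (d i)) (r : R) :
    matUnit e i a a * r * matUnit e i b b = e r i a b • matUnit e i a b := by
  apply e.injective
  funext k
  by_cases hk : k = i
  · subst hk
    simp [matUnit, Matrix.smul_single]
  · simp [matUnit, hk]

theorem matUnit_mul_mul_of_ne {i j : ι} (h : i ≠ j) (a : Fin (d i)) (b : Fin (d j)) (r : R) :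
    matUnit e i a a * r * matUnit e j b b = 0 := by
  apply e.injective
  funext k
  by_cases hk : k = i
  · subst hk
    simp [matUnit, h]
  · simp [matUnit, hk]

theorem eq_sum_smul_matUnit [Fintype ι] (r : R) :
    r = ∑ i, ∑ a, ∑ b, e r i a b • matUnit e i a b := by
  apply e.injective
  funext k
  conv_lhs => rw [Matrix.matrix_eq_sum_single (e r k)]
  simp only [map_sum, map_smul, matUnit, AlgEquiv.apply_symm_apply, Finset.sum_apply, Pi.smul_apply]
  rw [Finset.sum_eq_single k]
  · simp [Matrix.smul_single]
  · intro j _ hj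
    simp [Pi.single_eq_of_ne' hj]
  · simp

theorem sum_matUnit [Fintype ι] : ∑ i, ∑ a, matUnit e i a a = 1 := by
  conv_rhs => rw [eq_sum_smul_matUnit e 1]
  refine Finset.sum_congr rfl fun i _ => Finset.sum_congr rfl fun a _ => ?_
  simp [Matrix.one_apply]

section Corner

variable (M N : Type*) [AddCommGroup M] [Module F M] [Module R M] [IsScalarTower F R M]
  [AddCommGroup N] [Module F N] [Module R N] [IsScalarTower F R N] [∀ i, NeZero (d i)]

/-- The image of a primitive idempotent of the `i`-th block. -/
def corner (i : ι) : Submodule F M :=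
  LinearMap.range (Algebra.lsmul F F M (matUnit e i 0 0))

variable {M N}

theorem matUnit_smul_corner {i : ι} (x : corner e M i) : matUnit e i 0 0 • (x : M) = x := by
  obtain ⟨x, y, rfl⟩ := x
  simp [smul_smul, matUnit_mul_same]

theorem finrank_corner_congr (f : M ≃ₗ[R] N) (i : ι) :
    finrank F (corner e M i) = finrank F (corner e N i) := by
  let g : M ≃ₗ[F] N := f.restrictScalars F
  have : (corner e M i).map g.toLinearMap = corner e N i := by
    ext y
    constructor
    · rintro ⟨_, ⟨x, rfl⟩, rfl⟩
      exact ⟨f x, (f.map_smul _ x).symm⟩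
    · rintro ⟨x, rfl⟩
      refine ⟨_, ⟨f.symm x, rfl⟩, ?_⟩
      exact (f.map_smul _ _).trans (by simp)
  rw [← this]
  exact (g.submoduleMap _).finrank_eq

/-- The map `E₀ₐ : M → E₀₀ M`. -/
def toCorner (i : ι) (a : Fin (d i)) : M →ₗ[F] corner e M i :=
  (Algebra.lsmul F F M (matUnit e i 0 a)).codRestrict _ fun m =>
    ⟨matUnit e i 0 a • m, by simp [smul_smul, matUnit_mul_same]⟩

theorem coe_toCorner (i : ι) (a : Fin (d i)) (m : M) :
    (toCorner e i a m : M) = matUnit e i 0 a • m := rfl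

theorem finrank_corner_prod [Module.Finite F M] [Module.Finite F N] (i : ι) :
    finrank F (corner e (M × N) i) = finrank F (corner e M i) + finrank F (corner e N i) := by
  have : corner e (M × N) i = (corner e M i).prod (corner e N i) := by
    rw [corner, corner, corner, ← LinearMap.range_prodMap]
    rfl
  rw [this, ← finrank_prod]
  exact LinearEquiv.finrank_eq
    { toFun := fun x => (⟨x.1.1, x.2.1⟩, ⟨x.1.2, x.2.2⟩)
      map_add' := fun _ _ => rfl
      map_smul' := fun _ _ => rfl
      invFun := fun x => ⟨(x.1, x.2), x.1.2, x.2.2⟩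
      left_inv := fun _ => rfl
      right_inv := fun _ => rfl }

/-- The corner is E₀₀ R E₀₀, with the two idempotents taken from blocks j and i: a line spanned by
E₀₀ when the blocks agree, zero otherwise. So the left ideal R E₀₀ realizes a basis vector of
multiplicities. -/
theorem finrank_corner_span (i j : ι) :
    finrank F (corner e (Submodule.span R {matUnit e i 0 0}) j) = if j = i then 1 else 0 := by
  split_ifs with h
  · subst h
    let v : Submodule.span R {matUnit e j 0 0} :=
      ⟨matUnit e j 0 0, Submodule.mem_span_singleton_self _⟩
    have hv : v ∈ corner e (Submodule.span R {matUnit e j 0 0}) j :=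
      ⟨v, Subtype.ext (matUnit_mul_same e j 0 0 0)⟩
    rw [finrank_eq_one_iff_of_nonzero' ⟨v, hv⟩]
    · rintro ⟨_, ⟨w, hw⟩, rfl⟩
      obtain ⟨r, rfl⟩ := Submodule.mem_span_singleton.1 hw
      refine ⟨e r j 0 0, Subtype.ext (Subtype.ext ?_)⟩
      change e r j 0 0 • matUnit e j 0 0 = matUnit e j 0 0 * (r * matUnit e j 0 0)
      rw [← mul_assoc, matUnit_mul_mul]
    · intro h0
      exact matUnit_ne_zero e j 0 0 (congrArg (fun x => ((x : Submodule.span R {matUnit e j 0 0}) : R))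
        (congrArg Subtype.val h0))
  · have : corner e (Submodule.span R {matUnit e i 0 0}) j = ⊥ := by
      rw [eq_bot_iff]
      rintro _ ⟨⟨w, hw⟩, rfl⟩
      obtain ⟨r, rfl⟩ := Submodule.mem_span_singleton.1 hw
      apply Subtype.ext
      change matUnit e j 0 0 * (r * matUnit e i 0 0) = 0
      rw [← mul_assoc, matUnit_mul_mul_of_ne e h]
    rw [this, finrank_bot]

variable [Fintype ι]

/-- The map of `R`-modules induced by linear maps between the corners. -/
def ofCorner (φ : ∀ i, corner e M i →ₗ[F] corner e N i) : M →ₗ[F] N :=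
  ∑ i, ∑ a, (Algebra.lsmul F F N (matUnit e i a 0)).comp
    ((corner e N i).subtype.comp ((φ i).comp (toCorner e i a)))

variable (φ : ∀ i, corner e M i →ₗ[F] corner e N i)

theorem ofCorner_apply (m : M) :
    ofCorner e φ m = ∑ i, ∑ a, matUnit e i a 0 • (φ i (toCorner e i a m) : N) := by
  simp [ofCorner, LinearMap.sum_apply]

/-- Orthogonality of the matrix units leaves one term of the double sum. `matUnit_smul_ofCorner`
reaches the same term from the other side, and since matrix units span R over F, the two together
give R-linearity. -/
theorem ofCorner_matUnit_smul (j : ι) (b c : Fin (d j)) (m : M) :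
    ofCorner e φ (matUnit e j b c • m) = matUnit e j b 0 • (φ j (toCorner e j c m) : N) := by
  rw [ofCorner_apply, Finset.sum_eq_single j, Finset.sum_eq_single b]
  · congr 3
    apply Subtype.ext
    simp [coe_toCorner, smul_smul, matUnit_mul_same]
  · intro a _ ha
    have : toCorner e j a (matUnit e j b c • m) = 0 := by
      apply Subtype.ext
      simp [coe_toCorner, smul_smul, matUnit_mul_of_ne, ha]
    simp [this]
  · simp
  · intro i _ hi
    refine Finset.sum_eq_zero fun a _ => ?_
    have : toCorner e i a (matUnit e j b c • m) = 0 := by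
      apply Subtype.ext
      simp [coe_toCorner, smul_smul, matUnit_mul_of_ne_index e hi]
    simp [this]
  · simp

theorem matUnit_smul_ofCorner (j : ι) (b c : Fin (d j)) (m : M) :
    matUnit e j b c • ofCorner e φ m = matUnit e j b 0 • (φ j (toCorner e j c m) : N) := by
  simp only [ofCorner_apply, Finset.smul_sum, smul_smul]
  rw [Finset.sum_eq_single j, Finset.sum_eq_single c]
  · rw [matUnit_mul_same]
  · intro a _ ha
    rw [matUnit_mul_of_ne _ _ _ _ _ _ ha.symm, zero_smul]
  · simp
  · intro i _ hi
    refine Finset.sum_eq_zero fun a _ => ?_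
    rw [matUnit_mul_of_ne_index e hi.symm, zero_smul]
  · simp

theorem ofCorner_smul (r : R) (m : M) : ofCorner e φ (r • m) = r • ofCorner e φ m := by
  rw [eq_sum_smul_matUnit e r]
  simp only [Finset.sum_smul, map_sum, smul_assoc, map_smul, ofCorner_matUnit_smul,
    matUnit_smul_ofCorner]

theorem toCorner_ofCorner (i : ι) (a : Fin (d i)) (m : M) :
    toCorner e i a (ofCorner e φ m) = φ i (toCorner e i a m) := by
  apply Subtype.ext
  rw [coe_toCorner, matUnit_smul_ofCorner, matUnit_smul_corner]

theorem ofCorner_ofCorner (ψ : ∀ i, corner e N i →ₗ[F] corner e M i)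
    (h : ∀ i x, ψ i (φ i x) = x) (m : M) : ofCorner e ψ (ofCorner e φ m) = m := by
  rw [ofCorner_apply]
  simp only [toCorner_ofCorner, h, coe_toCorner, smul_smul, matUnit_mul_same]
  simp only [← Finset.sum_smul, sum_matUnit, one_smul]

/-- This is Morita equivalence block by block: m is recovered as ∑ E_{a0} (E_{0a} m), so
isomorphisms of the corners extend to M. -/
theorem nonempty_linearEquiv_of_corner (φ : ∀ i, corner e M i ≃ₗ[F] corner e N i) :
    Nonempty (M ≃ₗ[R] N) :=
  ⟨{ toFun := ofCorner e fun i => (φ i).toLinearMap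
     map_add' := map_add _
     map_smul' := ofCorner_smul e _
     invFun := ofCorner e fun i => (φ i).symm.toLinearMap
     left_inv := ofCorner_ofCorner e _ _ fun i x => (φ i).symm_apply_apply x
     right_inv := ofCorner_ofCorner e _ _ fun i x => (φ i).apply_symm_apply x }⟩

end Corner

variable [Fintype ι]

theorem finrank_center_of_algEquiv_pi_matrix [∀ i, NeZero (d i)]
    (e : R ≃ₐ[F] Π i, Matrix (Fin (d i)) (Fin (d i)) F) :
    finrank F (Subalgebra.center F R) = Fintype.card ι := by
  let φ : (ι → F) →ₗ[F] R :=
    { toFun := fun c => e.symm fun i => Matrix.scalar _ (c i)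
      map_add' := fun x y => by
        rw [← map_add]
        congr 1
        funext i
        simp
      map_smul' := fun x y => by
        rw [← map_smul]
        congr 1
        funext i
        ext a b
        simp [Matrix.diagonal_apply] }
  have hφ (c) : φ c ∈ Subalgebra.center F R := by
    rw [Subalgebra.mem_center_iff]
    intro b
    apply e.injective
    rw [map_mul, map_mul]
    funext i
    simp only [φ, LinearMap.coe_mk, AddHom.coe_mk, AlgEquiv.apply_symm_apply, Pi.mul_apply]
    exact (Matrix.scalar_commute (c i) (fun _ => Commute.all _ _) (e b i)).symm.eq
  let ψ : (ι → F) →ₗ[F] Subalgebra.center F R :=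
    φ.codRestrict (Subalgebra.toSubmodule (Subalgebra.center F R)) hφ
  have hψ : Function.Bijective ψ := by
    constructor
    · intro c c' h
      have h1 : φ c = φ c' := congrArg Subtype.val h
      funext i
      have h2 := congrFun (e.symm.injective h1) i
      simpa using h2
    · rintro ⟨z, hz⟩
      rw [Subalgebra.mem_center_iff] at hz
      -- An element that commutes with all matrix units is scalar in each block.
      have h1 (i : ι) : ∃ c : F, Matrix.scalar _ c = e z i := by
        have : e z i ∈ Set.range (Matrix.scalar (Fin (d i))) := by
          apply Matrix.mem_range_scalar_of_commute_single
          intro a b _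
          have := congrArg (fun w => e w i) (hz (matUnit e i a b))
          rw [commute_iff_eq]
          simpa [matUnit] using this
        exact this
      choose c hc using h1
      refine ⟨c, Subtype.ext (e.injective ?_)⟩
      funext i
      exact (congrFun (e.apply_symm_apply _) i).trans (hc i)
  rw [← (LinearEquiv.ofBijective ψ hψ).finrank_eq, finrank_fintype_fun_eq_card]

/-- For an algebra isomorphic to a product of matrix algebras, finitely generated projective modules
are classified by their multiplicities. -/
theorem nonempty_isoClass_addEquiv_of_algEquiv [∀ i, NeZero (d i)] [IsSemisimpleRing R]
    (e : R ≃ₐ[F] Π i, Matrix (Fin (d i)) (Fin (d i)) F) :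
    Nonempty (ProjMod.IsoClass R ≃+ (ι → ℕ)) := by
  let inst (M : ProjMod R) : Module F M.carrier := Module.compHom _ (algebraMap F R)
  have tower (M : ProjMod R) : IsScalarTower F R M.carrier := IsScalarTower.of_compHom F R _
  have : Module.Finite F R := Module.Finite.equiv e.symm.toLinearEquiv
  have fin (M : ProjMod R) : Module.Finite F M.carrier := Module.Finite.trans R _
  let f : ProjMod.IsoClass R →+ (ι → ℕ) :=
    { toFun := Quotient.lift (fun M i => finrank F (corner e M.carrier i))
        fun M N ⟨g⟩ => funext fun i => finrank_corner_congr e g i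
      map_zero' := funext fun i => by
        have : Subsingleton (ProjMod.zeroMod : ProjMod R).carrier :=
          inferInstanceAs (Subsingleton PUnit)
        exact finrank_zero_of_subsingleton
      map_add' := by
        rintro ⟨M⟩ ⟨N⟩
        exact funext fun i => finrank_corner_prod e i }
  refine ⟨AddEquiv.ofBijective f ⟨?_, ?_⟩⟩
  · rintro ⟨M⟩ ⟨N⟩ h
    exact Quotient.sound (nonempty_linearEquiv_of_corner e fun i =>
      LinearEquiv.ofFinrankEq _ _ (congrFun h i))
  -- The range is a submonoid, so it is enough to reach the standard basis vectors, which come from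
  -- the left ideals R E₀₀.
  · rw [← AddMonoidHom.mrange_eq_top, eq_top_iff]
    intro c _
    have hc : c = ∑ i, c i • (Pi.single i 1 : ι → ℕ) := by
      funext j
      simp [Finset.sum_apply, Pi.single_apply]
    rw [hc]
    refine sum_mem fun i _ => nsmul_mem ?_ _
    have : Module.Projective R (Submodule.span R {matUnit e i 0 0}) :=
      Module.projective_of_isSemisimpleRing _ _
    refine ⟨ProjMod.toIsoClass ⟨Submodule.span R {matUnit e i 0 0}⟩, funext fun j => ?_⟩
    rw [Pi.single_apply]
    exact (finrank_corner_congr (M := (⟨Submodule.span R {matUnit e i 0 0}⟩ : ProjMod R).carrier)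
      (N := Submodule.span R {matUnit e i 0 0}) e (LinearEquiv.refl R _) j).trans
      (finrank_corner_span e i j)

end SplitSemisimple

theorem KGroup.nonempty_addEquiv_pi_int {F : Type*} [Field F] [IsAlgClosed F] {R : Type u} [Ring R]
    [Algebra F R] [Module.Finite F R] [IsSemisimpleRing R] :
    Nonempty (KGroup R ≃+ (Fin (Module.finrank F (Subalgebra.center F R)) → ℤ)) := by
  obtain ⟨k, d, hd, ⟨e⟩⟩ := IsSemisimpleRing.exists_algEquiv_pi_matrix_of_isAlgClosed F R
  obtain ⟨f⟩ := nonempty_isoClass_addEquiv_of_algEquiv e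
  rw [finrank_center_of_algEquiv_pi_matrix e, Fintype.card_fin]
  exact ⟨(Algebra.GrothendieckAddGroup.congr f).trans (Algebra.GrothendieckAddGroup.piNat _)⟩

/-! ### Semisimplicity of the crossed product -/

section Maschke

open SkewMonoidAlgebra

variable {G : Type u} {A : Type v} [Group G] [Ring A] [MulSemiringAction G A]

theorem CrossedProduct.single_eq_mul (g : G) (a : A) :
    (single g a : CrossedProduct G A) = single 1 a * single g 1 := by
  simp

/-- An additive map which commutes with the actions of `A` and of `G` is linear over `G ⋉ A`. -/
theorem CrossedProduct.map_smul_of_single {M N : Type*} [AddCommGroup M] [AddCommGroup N]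
    [Module (CrossedProduct G A) M] [Module (CrossedProduct G A) N] (f : M →+ N)
    (hA : ∀ (a : A) m, f ((single 1 a : CrossedProduct G A) • m)
      = (single 1 a : CrossedProduct G A) • f m)
    (hG : ∀ (g : G) m, f ((single g 1 : CrossedProduct G A) • m)
      = (single g 1 : CrossedProduct G A) • f m)
    (r : CrossedProduct G A) (m : M) : f (r • m) = r • f m := by
  induction r using SkewMonoidAlgebra.induction_on' with
  | single g a => rw [single_eq_mul, mul_smul, mul_smul, hA, hG]
  | add x y hx hy => rw [add_smul, add_smul, map_add, hx, hy]

/-- Maschke's theorem for crossed products. -/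
theorem CrossedProduct.isSemisimpleRing [Finite G] [IsSemisimpleRing A] {F : Type*} [Field F]
    [CharZero F] [Algebra F A] [SMulCommClass G F A] : IsSemisimpleRing (CrossedProduct G A) := by
  have := Fintype.ofFinite G
  refine { exists_isCompl := fun N => ?_ }
  let R := CrossedProduct G A
  have hι (a : A) (x : R) : a • x = (single 1 a : R) • x := by
    ext g : 1
    simp [R]
  -- Over A alone the left ideal N has a complement, hence an A-linear projection p onto it.
  let N' : Submodule A R :=
    { N.toAddSubmonoid with smul_mem' := fun a x hx => hι a x ▸ N.smul_mem (single 1 a : R) hx }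
  obtain ⟨q, hq⟩ := exists_isCompl N'
  obtain ⟨p, hp⟩ : ∃ p : R →ₗ[A] R, (∀ x, p x ∈ N) ∧ ∀ x ∈ N, p x = x :=
    ⟨N'.subtype ∘ₗ Submodule.projectionOnto N' q hq, fun x =>
      (Submodule.projectionOnto N' q hq x).2, fun x hx =>
      congrArg Subtype.val (Submodule.projectionOnto_apply_left hq ⟨x, hx⟩)⟩
  obtain ⟨hpN, hpid⟩ := hp
  have hpA (a : A) (x : R) : p ((single 1 a : R) * x) = (single 1 a : R) * p x := by
    simpa only [hι, smul_eq_mul] using p.map_smul a x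
  -- The sum of the conjugates g p g⁻¹. It stays A-linear because g⁻¹ a = (g⁻¹ • a) g⁻¹, and it
  -- becomes G-linear by reindexing the sum.
  let P : R →+ R :=
    ∑ g : G, (AddMonoidHom.mulLeft (single g 1 : R)).comp
      (p.toAddMonoidHom.comp (AddMonoidHom.mulLeft (single g⁻¹ 1 : R)))
  have hP (x : R) : P x = ∑ g : G, (single g 1 : R) * p ((single g⁻¹ 1 : R) * x) := by
    simp [P, AddMonoidHom.finsetSum_apply]
  have hPA (a : A) (x : R) : P ((single 1 a : R) • x) = (single 1 a : R) • P x := by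
    simp only [hP, smul_eq_mul, Finset.mul_sum]
    refine Finset.sum_congr rfl fun g _ => ?_
    have h1 : (single g⁻¹ 1 : R) * (single 1 a * x) = single 1 (g⁻¹ • a) * (single g⁻¹ 1 * x) := by
      simp [← mul_assoc, R]
    rw [h1, hpA]
    simp [← mul_assoc, R]
  have hPG (h : G) (x : R) : P ((single h 1 : R) • x) = (single h 1 : R) • P x := by
    simp only [hP, smul_eq_mul, Finset.mul_sum]
    refine Fintype.sum_equiv (Equiv.mulLeft h⁻¹) _ _ fun g => ?_
    simp [← mul_assoc, R]
  -- Each summand of P fixes N pointwise, so P is multiplication by |G| on N, and c normalizes it to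
  -- a projection.
  let c : F := (Fintype.card G : F)⁻¹
  have hc : c * Fintype.card G = 1 := inv_mul_cancel₀ (by simp)
  let Q : R →ₗ[R] R :=
    { toFun := fun x => c • P x
      map_add' := fun x y => by simp
      map_smul' := fun r x => by
        rw [map_smul_of_single P hPA hPG]
        exact (smul_comm c r (P x)) }
  have hQN (x : R) : Q x ∈ N := by
    change c • P x ∈ N
    rw [← algebraMap_smul R c (P x), hP]
    exact N.smul_mem _ (N.sum_mem fun g _ => N.smul_mem _ (hpN _))
  have hQid (x : R) (hx : x ∈ N) : Q x = x := by
    change c • P x = x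
    rw [hP]
    have : ∀ g : G, (single g 1 : R) * p ((single g⁻¹ 1 : R) * x) = x := fun g => by
      have hmem : (single g⁻¹ 1 : R) * x ∈ N := N.smul_mem (single g⁻¹ 1 : R) hx
      rw [hpid _ hmem, ← mul_assoc]
      simp [R]
    rw [Finset.sum_congr rfl fun g _ => this g, Finset.sum_const, Finset.card_univ,
      ← Nat.cast_smul_eq_nsmul F, smul_smul, hc, one_smul]
  exact ⟨LinearMap.ker (Q.codRestrict N hQN), LinearMap.isCompl_of_proj fun x =>
    Subtype.ext (hQid x x.2)⟩

end Maschke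

/-! ### Equivariant A-modules as modules over the crossed product -/

section EquivariantModules

open SkewMonoidAlgebra

variable {G : Type u} {A : Type v} [Group G] [Ring A] [MulSemiringAction G A]

/-- Linearity over G ⋉ A amounts to commuting with A and with G. The two directions make the passage
from E to M well defined and injective on isomorphism classes. -/
theorem SameModule.equiv_iff {E E' : EquivProjMod G A} {M M' : ProjMod (CrossedProduct G A)}
    (h : SameModule E M) (h' : SameModule E' M') : E ≈ E' ↔ M ≈ M' := by
  obtain ⟨φ, hA, hG⟩ := h
  obtain ⟨φ', hA', hG'⟩ := h'
  constructor
  · rintro ⟨ψ, hψ⟩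
    let θ : M.carrier ≃+ M'.carrier := (φ.symm.trans ψ.toAddEquiv).trans φ'
    refine ⟨{ θ with map_smul' := CrossedProduct.map_smul_of_single θ.toAddMonoidHom ?_ ?_ }⟩
    · intro a m
      obtain ⟨e, rfl⟩ := φ.surjective m
      simp [θ, ← hA, ← hA']
    · intro g m
      obtain ⟨e, rfl⟩ := φ.surjective m
      simp [θ, ← hG, ← hG', hψ]
  · rintro ⟨ψ⟩
    let θ : E.carrier ≃+ E'.carrier := (φ.trans ψ.toAddEquiv).trans φ'.symm
    refine ⟨{ θ with map_smul' := fun a e => ?_ }, fun g e => ?_⟩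
    · apply φ'.injective
      simp [θ, hA, hA']
    · apply φ'.injective
      change φ' (θ (g • e)) = φ' (g • θ e)
      simp [θ, hG, hG']

theorem SameModule.dsum {E E' : EquivProjMod G A} {M M' : ProjMod (CrossedProduct G A)}
    (h : SameModule E M) (h' : SameModule E' M') : SameModule (E.dsum E') (M.dsum M') := by
  obtain ⟨φ, hA, hG⟩ := h
  obtain ⟨φ', hA', hG'⟩ := h'
  exact ⟨φ.prodCongr φ', fun a e => Prod.ext (hA a e.1) (hA' a e.2),
    fun g e => Prod.ext (hG g e.1) (hG' g e.2)⟩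

/-- The action of `G ⋉ A` on an equivariant module. -/
noncomputable def EquivProjMod.crossedProductToEnd (E : EquivProjMod G A) :
    CrossedProduct G A →+* AddMonoid.End E.carrier :=
  liftNCRingHom (Module.toAddMonoidEnd A E.carrier) (DistribMulAction.toAddMonoidEnd G E.carrier)
    fun {a g} => AddMonoidHom.ext fun e => (E.smul_smul' g a e).symm

theorem EquivProjMod.crossedProductToEnd_single (E : EquivProjMod G A) (g : G) (a : A)
    (e : E.carrier) : E.crossedProductToEnd (single g a) e = a • g • e := by
  exact DFunLike.congr_fun (liftNC_single (Module.toAddMonoidEnd A E.carrier : A →+ _)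
    (DistribMulAction.toAddMonoidEnd G E.carrier) g a) e

theorem EquivProjMod.exists_sameModule [IsSemisimpleRing (CrossedProduct G A)]
    (E : EquivProjMod G A) : ∃ M : ProjMod (CrossedProduct G A), SameModule E M := by
  let : Module (CrossedProduct G A) E.carrier := Module.compHom _ E.crossedProductToEnd
  have hs (g : G) (a : A) (e : E.carrier) : (single g a : CrossedProduct G A) • e = a • g • e :=
    E.crossedProductToEnd_single g a e
  have : Module.Finite (CrossedProduct G A) E.carrier := by
    obtain ⟨s, hsp⟩ := (inferInstance : Module.Finite A E.carrier)
    refine ⟨s, top_unique fun x _ => ?_⟩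
    have hx : x ∈ Submodule.span A (s : Set E.carrier) := hsp ▸ Submodule.mem_top
    induction hx using Submodule.span_induction with
    | mem x h => exact Submodule.subset_span h
    | zero => exact zero_mem _
    | add x y _ _ hx hy => exact add_mem (hx trivial) (hy trivial)
    | smul a x _ hx =>
      have := Submodule.smul_mem _ (single 1 a : CrossedProduct G A) (hx trivial)
      rwa [hs, one_smul] at this
  have : Module.Projective (CrossedProduct G A) E.carrier :=
    Module.projective_of_isSemisimpleRing _ _
  refine ⟨⟨E.carrier⟩, AddEquiv.refl _, fun a e => ?_, fun g e => ?_⟩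
  · exact ((hs 1 a e).trans (by rw [one_smul]; rfl)).symm
  · exact ((hs g 1 e).trans (one_smul _ _)).symm

theorem ProjMod.exists_sameModule [Finite G] [IsSemisimpleRing A]
    (M : ProjMod (CrossedProduct G A)) : ∃ E : EquivProjMod G A, SameModule E M := by
  let : Module A M.carrier := Module.compHom _ (singleOneRingHom : A →+* CrossedProduct G A)
  let : DistribMulAction G M.carrier := DistribMulAction.compHom _ (SkewMonoidAlgebra.of A G)
  have hA (a : A) (m : M.carrier) : a • m = (single 1 a : CrossedProduct G A) • m := rfl
  have hG (g : G) (m : M.carrier) : g • m = (single g 1 : CrossedProduct G A) • m := rfl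
  have : IsScalarTower A (CrossedProduct G A) M.carrier :=
    ⟨fun a r m => by
      rw [hA, smul_smul]
      congr 1
      ext g : 1
      simp⟩
  have : Module.Finite A (CrossedProduct G A) :=
    Module.Finite.equiv (coeffLinearEquiv (k := A) (G := G) (S := A)).symm
  have : Module.Finite A M.carrier := Module.Finite.trans (CrossedProduct G A) _
  have : Module.Projective A M.carrier := Module.projective_of_isSemisimpleRing _ _
  refine ⟨{ carrier := M.carrier, smul_smul' := fun g a e => ?_ }, AddEquiv.refl _,
    fun a e => rfl, fun g e => rfl⟩
  simp only [hA, hG, smul_smul]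
  simp

/-- Isomorphism classes of equivariant `A`-modules are isomorphism classes of
`G ⋉ A`-modules. -/
theorem EquivProjMod.exists_isoClass_addEquiv [Finite G] [IsSemisimpleRing A]
    [IsSemisimpleRing (CrossedProduct G A)] :
    ∃ e : EquivProjMod.IsoClass G A ≃+ ProjMod.IsoClass (CrossedProduct G A),
      ∀ E M, SameModule E M → e E.toIsoClass = M.toIsoClass := by
  choose f hf using EquivProjMod.exists_sameModule (G := G) (A := A)
  let F : EquivProjMod.IsoClass G A → ProjMod.IsoClass (CrossedProduct G A) :=
    Quotient.map f fun E E' h => (SameModule.equiv_iff (hf E) (hf E')).1 h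
  have hF (E : EquivProjMod G A) (M) (h : SameModule E M) : F E.toIsoClass = M.toIsoClass :=
    Quotient.sound ((SameModule.equiv_iff (hf E) h).1 (Setoid.refl E))
  have hadd (x y) : F (x + y) = F x + F y := by
    induction x using Quotient.inductionOn with | _ E =>
    induction y using Quotient.inductionOn with | _ E' =>
    exact hF (E.dsum E') _ ((hf E).dsum (hf E'))
  have hbij : Function.Bijective F := by
    constructor
    · intro x y
      induction x using Quotient.inductionOn with | _ E =>
      induction y using Quotient.inductionOn with | _ E' =>
      intro h
      exact Quotient.sound ((SameModule.equiv_iff (hf E) (hf E')).2 (Quotient.exact h))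
    · intro y
      induction y using Quotient.inductionOn with | _ M =>
      obtain ⟨E, hE⟩ := M.exists_sameModule
      exact ⟨E.toIsoClass, hF E M hE⟩
  exact ⟨{ Equiv.ofBijective F hbij with map_add' := hadd }, hF⟩

end EquivariantModules

/-! ### Implementing `*`-automorphisms by special unitary matrices -/

section UnitaryImplementation

/-- A `*`-automorphism of `M_n(ℂ)` is conjugation by a matrix in `SU(n)`. -/
theorem exists_specialUnitary_conj {n : ℕ} [NeZero n] (f : MatC n ≃ₐ[ℂ] MatC n)
    (hf : ∀ a, f (star a) = star (f a)) :
    ∃ s : Matrix.specialUnitaryGroup (Fin n) ℂ, ∀ a : MatC n, f a = (s : MatC n) * a *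
      ((s⁻¹ : Matrix.specialUnitaryGroup (Fin n) ℂ) : MatC n) := by
  -- Skolem–Noether: f is conjugation by an invertible matrix t.
  obtain ⟨T, hT⟩ := ((Matrix.toLinAlgEquiv' (R := ℂ) (n := Fin n)).symm.trans
    (f.trans Matrix.toLinAlgEquiv')).eq_linearEquivConjAlgEquiv
  obtain ⟨t, t', htt', ht't, ht⟩ : ∃ t t' : MatC n, t * t' = 1 ∧ t' * t = 1 ∧
      ∀ a, f a = t * a * t' := by
    refine ⟨LinearMap.toMatrixAlgEquiv' T.toLinearMap, LinearMap.toMatrixAlgEquiv'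
      T.symm.toLinearMap, ?_, ?_, fun a => ?_⟩
    · rw [← LinearMap.toMatrixAlgEquiv'_mul]
      exact (congrArg _ (LinearMap.ext fun x => by simp)).trans
        (map_one (LinearMap.toMatrixAlgEquiv' (R := ℂ) (n := Fin n)))
    · rw [← LinearMap.toMatrixAlgEquiv'_mul]
      exact (congrArg _ (LinearMap.ext fun x => by simp)).trans
        (map_one (LinearMap.toMatrixAlgEquiv' (R := ℂ) (n := Fin n)))
    · apply (Matrix.toLinAlgEquiv' (R := ℂ) (n := Fin n)).injective
      have := congrArg (fun h => h (Matrix.toLinAlgEquiv' a)) hT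
      simp only [AlgEquiv.trans_apply, AlgEquiv.symm_apply_apply] at this
      rw [this]
      simp only [map_mul, Matrix.toLinAlgEquiv'_toMatrixAlgEquiv']
      rfl
  have hdet : t.det ≠ 0 := fun h => by
    have := congrArg Matrix.det htt'
    simp [h] at this
  -- Rescaling t by w does not change the conjugation and brings the determinant to 1.
  obtain ⟨w, hw⟩ := IsAlgClosed.exists_pow_nat_eq (t.det)⁻¹ (NeZero.pos n)
  let s : MatC n := w • t
  have hsdet : s.det = 1 := by
    simp [s, hw, hdet]
  -- Compatibility with `star` forces t* t to be central, so s* s will be a scalar c.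
  have hcomm (a : MatC n) : Commute a (star t * t) := by
    have h := hf (star a)
    rw [star_star, ht, ht, star_mul, star_mul, star_star] at h
    have h1 : star t * star t' = 1 := by rw [← star_mul, ht't, star_one]
    calc a * (star t * t) = star t * (star t' * (a * star t)) * t := by
          simp only [← mul_assoc, h1, one_mul]
      _ = star t * (t * a * t') * t := by rw [h]
      _ = star t * t * a := by simp only [mul_assoc, ht't, mul_one]
  obtain ⟨c, hc⟩ : star s * s ∈ Set.range (Matrix.scalar (Fin n)) :=
    Matrix.mem_range_scalar_of_commute_single fun i j _ => by
      have : star s * s = (star w * w) • (star t * t) := by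
        simp [s, smul_smul, mul_comm]
      rw [this]
      exact (hcomm _).smul_right _
  have hcn : c ^ n = 1 := by
    have h := congrArg Matrix.det hc
    rw [Matrix.det_mul, hsdet, Matrix.star_eq_conjTranspose, Matrix.det_conjTranspose, hsdet] at h
    simpa using h
  -- As a diagonal entry of s* s, c is the squared norm of a column of s, hence a nonnegative real;
  -- the only such n-th root of unity is 1.
  have hc1 : c = 1 := by
    obtain ⟨x, hx0, rfl⟩ : ∃ x : ℝ, 0 ≤ x ∧ c = x := by
      refine ⟨∑ k, Complex.normSq (s k 0), Finset.sum_nonneg fun _ _ => Complex.normSq_nonneg _, ?_⟩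
      have h := congrFun (congrFun hc 0) 0
      simp only [Matrix.scalar_apply, Matrix.diagonal_apply_eq, Matrix.mul_apply,
        Matrix.star_apply] at h
      rw [h, Complex.ofReal_sum]
      exact Finset.sum_congr rfl fun k _ => (Complex.normSq_eq_conj_mul_self).symm
    have hxn : x ^ n = 1 := by exact_mod_cast hcn
    rw [(pow_eq_one_iff_of_nonneg hx0 (NeZero.ne n)).1 hxn, Complex.ofReal_one]
  have hmem : s ∈ Matrix.specialUnitaryGroup (Fin n) ℂ := by
    rw [Matrix.mem_specialUnitaryGroup_iff, Matrix.mem_unitaryGroup_iff']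
    exact ⟨by rw [← hc, hc1, map_one], hsdet⟩
  refine ⟨⟨s, hmem⟩, fun a => ?_⟩
  have h1 : f a * s = s * a := by
    simp only [ht, s, Matrix.mul_smul, Matrix.smul_mul, mul_assoc, ht't, mul_one]
  have h2 : s * (((⟨s, hmem⟩ : Matrix.specialUnitaryGroup (Fin n) ℂ)⁻¹ :
      Matrix.specialUnitaryGroup (Fin n) ℂ) : MatC n) = 1 :=
    congrArg Subtype.val (mul_inv_cancel (⟨s, hmem⟩ : Matrix.specialUnitaryGroup (Fin n) ℂ))
  rw [← h1, mul_assoc, h2, mul_one]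

theorem TildeGroup.proj_surjective {G : Type u} [Group G] (n : ℕ) [NeZero n]
    [MulSemiringAction G (MatC n)] [SMulCommClass G ℂ (MatC n)]
    (hstar : ∀ (g : G) (a : MatC n), g • star a = star (g • a)) :
    Function.Surjective (TildeGroup.proj G n) := by
  intro g
  obtain ⟨s, hs⟩ := exists_specialUnitary_conj (MulSemiringAction.toAlgEquiv ℂ (MatC n) g)
    (hstar g)
  exact ⟨⟨(g, s), hs⟩, rfl⟩

end UnitaryImplementation

/-! ### Conjugacy classes of G̃ and functions of linear type -/

namespace TildeGroup

variable {G : Type u} {n : ℕ} [Group G] [NeZero n] [MulSemiringAction G (MatC n)]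

theorem ofMu_mul (z w : rootsOfUnity n ℂ) : ofMu G n (z * w) = ofMu G n z * ofMu G n w := by
  apply Subtype.ext
  refine Prod.ext (mul_one 1).symm (Subtype.ext ?_)
  change Matrix.scalar (Fin n) (((z * w : rootsOfUnity n ℂ) : ℂˣ) : ℂ)
    = Matrix.scalar (Fin n) ((z : ℂˣ) : ℂ) * Matrix.scalar (Fin n) ((w : ℂˣ) : ℂ)
  rw [← map_mul]
  rfl

theorem ofMu_one : ofMu G n 1 = 1 := by
  have h := ofMu_mul (G := G) (1 : rootsOfUnity n ℂ) 1
  rw [mul_one] at h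
  exact (right_eq_mul.1 h)

theorem proj_ofMu (z : rootsOfUnity n ℂ) : proj G n (ofMu G n z) = 1 := rfl

theorem ofMu_comm (z : rootsOfUnity n ℂ) (x : TildeGroup G n) :
    ofMu G n z * x = x * ofMu G n z := by
  apply Subtype.ext
  refine Prod.ext ((one_mul _).trans (mul_one _).symm) (Subtype.ext ?_)
  exact (Matrix.scalar_commute _ (fun _ => Commute.all _ _) _).eq

/-- A matrix implementing the trivial automorphism is central, hence scalar, and determinant 1 makes
the scalar an n-th root of unity. -/
theorem exists_ofMu_of_proj_eq_one (x : TildeGroup G n) (hx : proj G n x = 1) :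
    ∃ z, x = ofMu G n z := by
  obtain ⟨⟨g, s⟩, h⟩ := x
  obtain rfl : g = 1 := hx
  have hcomm (a : MatC n) : Commute a (s : MatC n) := by
    have h1 : (1 : G) • a = (s : MatC n) * a * ((s⁻¹ : Matrix.specialUnitaryGroup (Fin n) ℂ) :
      MatC n) := h a
    have h2 : ((s⁻¹ : Matrix.specialUnitaryGroup (Fin n) ℂ) : MatC n) * (s : MatC n) = 1 := by
      rw [← Submonoid.coe_mul, inv_mul_cancel, Submonoid.coe_one]
    calc a * (s : MatC n) = (1 : G) • a * (s : MatC n) := by rw [one_smul]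
      _ = s * a := by rw [h1, mul_assoc, h2, mul_one]
  obtain ⟨c, hc⟩ : (s : MatC n) ∈ Set.range (Matrix.scalar (Fin n)) :=
    Matrix.mem_range_scalar_of_commute_single fun i j _ => hcomm _
  have hcn : c ^ n = 1 := by
    have := (Matrix.mem_specialUnitaryGroup_iff.1 s.2).2
    rw [← hc] at this
    simpa using this
  refine ⟨rootsOfUnity.mkOfPowEq c hcn, Subtype.ext (Prod.ext rfl (Subtype.ext ?_))⟩
  exact hc.symm

theorem exists_ofMu_mul_of_proj_eq {x y : TildeGroup G n} (h : proj G n x = proj G n y) :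
    ∃ z, x = ofMu G n z * y := by
  obtain ⟨z, hz⟩ := exists_ofMu_of_proj_eq_one (x * y⁻¹) (by rw [map_mul, map_inv, h, mul_inv_cancel])
  exact ⟨z, by rw [← hz, inv_mul_cancel_right]⟩

theorem isConj_ofMu_mul {x y : TildeGroup G n} (z : rootsOfUnity n ℂ) (h : IsConj x y) :
    IsConj (ofMu G n z * x) (ofMu G n z * y) := by
  obtain ⟨c, rfl⟩ := isConj_iff.1 h
  exact isConj_iff.2 ⟨c, by rw [← mul_assoc c, ← ofMu_comm]; simp only [mul_assoc]⟩

/-- Lift the conjugating element to G̃; what remains lies in the kernel μ_n. Thus μ_n acts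
transitively on the classes above a given one. -/
theorem exists_isConj_ofMu_mul (hπ : Function.Surjective (proj G n)) {x y : TildeGroup G n}
    (h : IsConj (proj G n x) (proj G n y)) : ∃ z, IsConj x (ofMu G n z * y) := by
  obtain ⟨c, hc⟩ := isConj_iff.1 h
  obtain ⟨c, rfl⟩ := hπ c
  obtain ⟨z, hz⟩ := exists_ofMu_mul_of_proj_eq (x := c * x * c⁻¹) (y := y) (by simpa using hc)
  exact ⟨z, isConj_iff.2 ⟨c, hz⟩⟩

/-- A conjugacy class of `G` splits into `n` classes if and only if the conjugates
`λ x` of an element `x` above it are all equal to `x`. -/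
theorem card_fiber_eq_iff (hπ : Function.Surjective (proj G n)) (x : TildeGroup G n) :
    Nat.card {D : ConjClasses (TildeGroup G n) //
      ConjClasses.map (proj G n) D = ConjClasses.mk (proj G n x)} = n ↔
    ∀ z, IsConj (ofMu G n z * x) x → z = 1 := by
  -- The orbit map from μ_n onto the fibre. As μ_n has n elements, the fibre has n exactly when this
  -- map is injective.
  let q : rootsOfUnity n ℂ → {D : ConjClasses (TildeGroup G n) //
      ConjClasses.map (proj G n) D = ConjClasses.mk (proj G n x)} :=
    fun z => ⟨ConjClasses.mk (ofMu G n z * x), by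
      change ConjClasses.mk (proj G n (ofMu G n z * x)) = _
      rw [map_mul, proj_ofMu, one_mul]⟩
  have hq : Function.Surjective q := by
    rintro ⟨D, hD⟩
    obtain ⟨y, rfl⟩ := ConjClasses.exists_rep D
    obtain ⟨z, hz⟩ := exists_isConj_ofMu_mul hπ (ConjClasses.mk_eq_mk_iff_isConj.1 hD)
    exact ⟨z, Subtype.ext (ConjClasses.mk_eq_mk_iff_isConj.2 hz.symm)⟩
  have hcard : Nat.card (rootsOfUnity n ℂ) = n := by
    rw [Complex.card_rootsOfUnity]
  have hinj : Function.Injective q ↔ ∀ z, IsConj (ofMu G n z * x) x → z = 1 := by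
    constructor
    · intro h z hz
      apply h
      apply Subtype.ext
      change ConjClasses.mk _ = ConjClasses.mk _
      rwa [ofMu_one, one_mul, ConjClasses.mk_eq_mk_iff_isConj]
    · intro h z w hzw
      have h1 : IsConj (ofMu G n z * x) (ofMu G n w * x) :=
        ConjClasses.mk_eq_mk_iff_isConj.1 (congrArg Subtype.val hzw)
      have h2 := isConj_ofMu_mul w⁻¹ h1
      rw [← mul_assoc, ← mul_assoc, ← ofMu_mul, ← ofMu_mul, inv_mul_cancel, ofMu_one,
        one_mul] at h2
      exact (inv_mul_eq_one.1 (h _ h2)).symm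
  rw [← hinj]
  constructor
  · intro h
    exact ((Nat.bijective_iff_surjective_and_card q).2 ⟨hq, by rw [hcard, h]⟩).1
  · intro h
    rw [← Nat.card_congr (Equiv.ofBijective q ⟨h, hq⟩), hcard]

theorem LinearTypeFun.eq_of_isConj {f : TildeGroup G n → ℂ} (hf : f ∈ LinearTypeFun G n)
    {x y : TildeGroup G n} (h : IsConj x y) : f x = f y := by
  obtain ⟨c, rfl⟩ := isConj_iff.1 h
  exact (hf.1 c x).symm

/-- Functions of linear type correspond to functions on the set of splitting classes. -/
theorem nonempty_linearTypeFun_equiv (hπ : Function.Surjective (proj G n)) :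
    Nonempty (LinearTypeFun G n ≃ₗ[ℂ] (SplitClass G n → ℂ)) := by
  classical
  have hrep (C : SplitClass G n) : ∃ x, ConjClasses.mk (proj G n x) = C.1 := by
    obtain ⟨g, hg⟩ := ConjClasses.exists_rep C.1
    obtain ⟨x, rfl⟩ := hπ g
    exact ⟨x, hg⟩
  choose r hr using hrep
  have huniq (C : SplitClass G n) (z w : rootsOfUnity n ℂ) (x : TildeGroup G n)
      (hz : IsConj x (ofMu G n z * r C)) (hw : IsConj x (ofMu G n w * r C)) : z = w := by
    have h := (card_fiber_eq_iff hπ (r C)).1 (by rw [hr]; exact C.2)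
    have h2 := isConj_ofMu_mul w⁻¹ (hz.symm.trans hw)
    rw [← mul_assoc, ← mul_assoc, ← ofMu_mul, ← ofMu_mul, inv_mul_cancel, ofMu_one,
      one_mul] at h2
    exact (inv_mul_eq_one.1 (h _ h2)).symm
  have hex (C : SplitClass G n) (x : TildeGroup G n) (hx : ConjClasses.mk (proj G n x) = C.1) :
      ∃ z, IsConj x (ofMu G n z * r C) :=
    exists_isConj_ofMu_mul hπ (ConjClasses.mk_eq_mk_iff_isConj.1 (hx.trans (hr C).symm))
  let ev : LinearTypeFun G n →ₗ[ℂ] (SplitClass G n → ℂ) :=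
    { toFun := fun f C => f.1 (r C)
      map_add' := fun _ _ => rfl
      map_smul' := fun _ _ => rfl }
  refine ⟨LinearEquiv.ofBijective ev ⟨?_, ?_⟩⟩
  · rw [injective_iff_map_eq_zero]
    rintro ⟨f, hf⟩ h0
    apply Subtype.ext
    funext x
    change f x = 0
    by_cases hs : Nat.card {D : ConjClasses (TildeGroup G n) //
        ConjClasses.map (proj G n) D = ConjClasses.mk (proj G n x)} = n
    · obtain ⟨z, hz⟩ := hex ⟨_, hs⟩ x rfl
      rw [LinearTypeFun.eq_of_isConj hf hz, hf.2]
      have : f (r ⟨_, hs⟩) = 0 := congrFun h0 ⟨_, hs⟩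
      rw [this, mul_zero]
    -- Above a class that does not split, f x = λ f x for some λ ≠ 1.
    · rw [card_fiber_eq_iff hπ] at hs
      push Not at hs
      obtain ⟨z, hz, hz1⟩ := hs
      have h1 := LinearTypeFun.eq_of_isConj hf hz
      rw [hf.2] at h1
      by_contra hne
      refine hz1 (Subtype.ext (Units.ext ?_))
      exact (mul_eq_right₀ hne).1 h1
  · intro c
    -- The graph of the extension of c: the value is λ c(C) at conjugates of λ r(C), and 0 above the
    -- other classes. It is single-valued because μ_n acts freely above C.
    let P (x : TildeGroup G n) (v : ℂ) : Prop :=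
      (∃ C z, IsConj x (ofMu G n z * r C) ∧ v = ((z : ℂˣ) : ℂ) * c C) ∨
        ((¬ ∃ C : SplitClass G n, ConjClasses.mk (proj G n x) = C.1) ∧ v = 0)
    have hclass {x : TildeGroup G n} {C : SplitClass G n} {z}
        (h : IsConj x (ofMu G n z * r C)) : ConjClasses.mk (proj G n x) = C.1 := by
      rw [← hr C, ConjClasses.mk_eq_mk_iff_isConj]
      simpa [proj_ofMu] using (proj G n).map_isConj h
    have hPex (x) : ∃ v, P x v := by
      by_cases h : ∃ C : SplitClass G n, ConjClasses.mk (proj G n x) = C.1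
      · obtain ⟨C, hC⟩ := h
        obtain ⟨z, hz⟩ := hex C x hC
        exact ⟨_, Or.inl ⟨C, z, hz, rfl⟩⟩
      · exact ⟨0, Or.inr ⟨h, rfl⟩⟩
    have hPuniq (x v w) (hv : P x v) (hw : P x w) : v = w := by
      rcases hv with ⟨C, z, hz, rfl⟩ | ⟨hn, rfl⟩ <;> rcases hw with ⟨C', z', hz', rfl⟩ | ⟨hn', rfl⟩
      · obtain rfl : C = C' := Subtype.ext ((hclass hz).symm.trans (hclass hz'))
        rw [huniq C z z' x hz hz']
      · exact absurd ⟨C, hclass hz⟩ hn'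
      · exact absurd ⟨C', hclass hz'⟩ hn
      · rfl
    choose f hf using hPex
    refine ⟨⟨f, fun h x => hPuniq (h * x * h⁻¹) _ _ (hf _) ?_, fun z x =>
      hPuniq (ofMu G n z * x) _ _ (hf _) ?_⟩, funext fun C => ?_⟩
    · have hc : IsConj (h * x * h⁻¹) x := (isConj_iff.2 ⟨h, rfl⟩).symm
      rcases hf x with ⟨C, z, hz, hv⟩ | ⟨hn, hv⟩
      · exact Or.inl ⟨C, z, hc.trans hz, hv⟩
      · refine Or.inr ⟨?_, hv⟩
        rwa [ConjClasses.mk_eq_mk_iff_isConj.2 ((proj G n).map_isConj hc)]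
    · rcases hf x with ⟨C, w, hz, hv⟩ | ⟨hn, hv⟩
      · refine Or.inl ⟨C, z * w, ?_, ?_⟩
        · rw [ofMu_mul, mul_assoc]
          exact isConj_ofMu_mul z hz
        · rw [hv, ← mul_assoc]
          rfl
      · refine Or.inr ⟨?_, by rw [hv, mul_zero]⟩
        rwa [map_mul, proj_ofMu, one_mul]
    · refine hPuniq (r C) _ _ (hf _) (Or.inl ⟨C, 1, ?_, ?_⟩)
      · rw [ofMu_one, one_mul]
      · simp

end TildeGroup

/-! ### The center of the crossed product -/

namespace TildeGroup

open SkewMonoidAlgebra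

variable {G : Type u} {n : ℕ} [Group G] [MulSemiringAction G (MatC n)]

/-- The matrix underlying an element of `G̃`. -/
def mat : TildeGroup G n →* MatC n :=
  (Submonoid.subtype _).comp
    ((MonoidHom.snd G (Matrix.specialUnitaryGroup (Fin n) ℂ)).comp (TildeGroup G n).subtype)

theorem mat_ofMu [NeZero n] (z : rootsOfUnity n ℂ) :
    mat (ofMu G n z) = ((z : ℂˣ) : ℂ) • (1 : MatC n) := by
  change Matrix.scalar (Fin n) ((z : ℂˣ) : ℂ) = _
  rw [Matrix.scalar_apply, Matrix.smul_one_eq_diagonal]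

theorem mat_mul_mat_inv (x : TildeGroup G n) : mat x * mat x⁻¹ = 1 := by
  rw [← map_mul, mul_inv_cancel, map_one]

theorem mat_inv_mul_mat (x : TildeGroup G n) : mat x⁻¹ * mat x = 1 := by
  rw [← map_mul, inv_mul_cancel, map_one]

theorem proj_smul (x : TildeGroup G n) (a : MatC n) :
    proj G n x • a = mat x * a * mat x⁻¹ := x.2 a

variable [SMulCommClass G ℂ (MatC n)]

theorem coeff_smul_of_mem_center {z : CrossedProduct G (MatC n)}
    (hz : z ∈ Subalgebra.center ℂ (CrossedProduct G (MatC n))) (h g : G) :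
    z.coeff (h * g * h⁻¹) = h • z.coeff g := by
  have h1 := congrArg (fun w => w.coeff (h * g)) (Subalgebra.mem_center_iff.1 hz (single h 1))
  simpa using h1.symm

/-- With s = `mat x` above g, comparing coefficients of a z = z a at g gives a z_g = z_g (s a s⁻¹);
multiply by s on the right. -/
theorem commute_coeff_mul_mat {z : CrossedProduct G (MatC n)}
    (hz : z ∈ Subalgebra.center ℂ (CrossedProduct G (MatC n))) (x : TildeGroup G n) (a : MatC n) :
    Commute a (z.coeff (proj G n x) * mat x) := by
  have h1 := congrArg (fun w => w.coeff (proj G n x)) (Subalgebra.mem_center_iff.1 hz (single 1 a))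
  have h2 : a * z.coeff (proj G n x) = z.coeff (proj G n x) * (mat x * a * mat x⁻¹) := by
    simpa [← proj_smul] using h1
  rw [commute_iff_eq, ← mul_assoc, h2]
  simp only [mul_assoc, mat_inv_mul_mat, mul_one]

variable [NeZero n]

/-- The center of `G ⋉ M_n(ℂ)` is the space of functions of linear type on `G̃`. -/
theorem nonempty_center_equiv_linearTypeFun [Finite G] (hπ : Function.Surjective (proj G n)) :
    Nonempty (Subalgebra.center ℂ (CrossedProduct G (MatC n)) ≃ₗ[ℂ] LinearTypeFun G n) := by
  let T : Subalgebra.center ℂ (CrossedProduct G (MatC n)) →ₗ[ℂ] LinearTypeFun G n :=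
    { toFun := fun z => ⟨fun x => (z.1.coeff (proj G n x) * mat x).trace, fun h x => by
          beta_reduce
          rw [map_mul (proj G n), map_mul (proj G n), map_inv, coeff_smul_of_mem_center z.2,
            proj_smul, map_mul mat, map_mul mat, Matrix.trace_mul_comm]
          have : mat h * mat x * mat h⁻¹ * (mat h * z.1.coeff (proj G n x) * mat h⁻¹)
              = mat h * (mat x * z.1.coeff (proj G n x) * mat h⁻¹) := by
            simp only [mul_assoc]
            rw [← mul_assoc (mat h⁻¹) (mat h), mat_inv_mul_mat, one_mul]
          rw [this, Matrix.trace_mul_comm, mul_assoc, mat_inv_mul_mat, mul_one,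
            Matrix.trace_mul_comm], fun w x => by
          beta_reduce
          rw [map_mul, proj_ofMu, one_mul, map_mul, mat_ofMu]
          simp⟩
      map_add' := fun z w => Subtype.ext (funext fun x => by simp [add_mul])
      map_smul' := fun c z => Subtype.ext (funext fun x => by simp) }
  refine ⟨LinearEquiv.ofBijective T ⟨?_, ?_⟩⟩
  · rw [injective_iff_map_eq_zero]
    rintro ⟨z, hz⟩ h0
    apply Subtype.ext
    apply SkewMonoidAlgebra.ext
    intro g
    obtain ⟨x, rfl⟩ := hπ g
    obtain ⟨c, hc⟩ : z.coeff (proj G n x) * mat x ∈ Set.range (Matrix.scalar (Fin n)) :=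
      Matrix.mem_range_scalar_of_commute_single fun i j _ => commute_coeff_mul_mat hz x _
    have htr : (z.coeff (proj G n x) * mat x).trace = 0 :=
      congrFun (congrArg Subtype.val h0) x
    -- The trace of the scalar matrix c is n c.
    have hc0 : c = 0 := by
      rw [← hc] at htr
      simpa [NeZero.ne n] using htr
    rw [hc0, map_zero] at hc
    change z.coeff (proj G n x) = 0
    rw [← mul_one (z.coeff (proj G n x)), ← mat_mul_mat_inv x, ← mul_assoc, ← hc, zero_mul]
  · rintro ⟨f, hf⟩
    choose l hl using hπ
    -- The scalar matrix z_g s must have trace f x, which forces this coefficient. Under x ↦ λ x the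
    -- factor λ from f cancels λ⁻¹ from the inverse matrix, so b depends only on π x.
    let b (x : TildeGroup G n) : MatC n := ((n : ℂ)⁻¹ * f x) • mat x⁻¹
    have hb (w : rootsOfUnity n ℂ) (x) : b (ofMu G n w * x) = b x := by
      have hw : mat (ofMu G n w)⁻¹ = ((w : ℂˣ) : ℂ)⁻¹ • (1 : MatC n) := by
        have h := mat_inv_mul_mat (ofMu G n w)
        rw [mat_ofMu, Matrix.mul_smul, mul_one] at h
        rw [← h, smul_smul, inv_mul_cancel₀ (Units.ne_zero _), one_smul]
      simp only [b]
      rw [hf.2, mul_inv_rev, map_mul, hw, Matrix.mul_smul, mul_one, smul_smul]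
      congr 1
      have := Units.ne_zero (w : ℂˣ)
      field_simp
    have hb' {x y : TildeGroup G n} (h : proj G n x = proj G n y) : b x = b y := by
      obtain ⟨w, rfl⟩ := exists_ofMu_mul_of_proj_eq h
      exact hb w y
    let z : CrossedProduct G (MatC n) := ⟨Finsupp.equivFunOnFinite.symm fun g => b (l g)⟩
    have hz (x : TildeGroup G n) : z.coeff (proj G n x) = b x := hb' (hl _)
    have hcent : z ∈ Subalgebra.center ℂ (CrossedProduct G (MatC n)) := by
      rw [Subalgebra.mem_center_iff]
      intro r
      induction r using SkewMonoidAlgebra.induction_on' with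
      | add r r' h h' => rw [add_mul, mul_add, h, h']
      | single h a =>
        apply SkewMonoidAlgebra.ext
        intro y
        obtain ⟨t, rfl⟩ : ∃ t, proj G n t = h := ⟨l h, hl h⟩
        obtain ⟨x, hx⟩ : ∃ x, proj G n x = y * (proj G n t)⁻¹ := ⟨l _, hl _⟩
        obtain rfl : y = proj G n x * proj G n t := by rw [hx]; group
        -- At π(x) π(t) one product involves f (t⁻¹ x t) and the other f x, which agree since f is a
        -- class function; the matrix factors then both reduce to a s⁻¹, with s = `mat x`.
        have h1 : (proj G n t)⁻¹ * (proj G n x * proj G n t) = proj G n (t⁻¹ * x * t) := by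
          simp [mul_assoc]
        have h2 : f (t⁻¹ * x * t) = f x := by simpa using hf.1 t⁻¹ x
        rw [coeff_single_mul, coeff_mul_single, mul_inv_cancel_right, h1, hz, hz, proj_smul,
          proj_smul]
        simp only [b, h2]
        simp only [mul_inv_rev, inv_inv, map_mul, Matrix.mul_smul, Matrix.smul_mul,
          mul_assoc, mat_mul_mat_inv, mul_one]
        congr 1
        rw [← mul_assoc (mat x⁻¹) (mat x), mat_inv_mul_mat, one_mul, ← mul_assoc (mat t) (mat t⁻¹),
          mat_mul_mat_inv, one_mul]
    refine ⟨⟨z, hcent⟩, Subtype.ext (funext fun x => ?_)⟩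
    change (z.coeff (proj G n x) * mat x).trace = f x
    rw [hz]
    simp only [b, Matrix.smul_mul, mat_inv_mul_mat, Matrix.trace_smul, Matrix.trace_one,
      Fintype.card_fin, smul_eq_mul]
    have : (n : ℂ) ≠ 0 := by simp [NeZero.ne n]
    field_simp

end TildeGroup

theorem theorem6p5 {G : Type u} [Group G] [Finite G] (n : ℕ) [NeZero n]
    -- `G` acts on the `*`-algebra `A = M_n(ℂ)` by (`ℂ`-linear) `*`-automorphisms
    [MulSemiringAction G (MatC n)] [SMulCommClass G ℂ (MatC n)]
    (hstar : ∀ (g : G) (a : MatC n), g • star a = star (g • a)) :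
    -- the identification `K_G(A) = K(G ⋉ A)`
    (∃ Φ : EquivKGroup G (MatC n) ≃+ KGroup (CrossedProduct G (MatC n)),
      ∀ (E : EquivProjMod G (MatC n)) (M : ProjMod (CrossedProduct G (MatC n))),
        SameModule E M → Φ E.toK = M.toK) ∧
    -- `K(G ⋉ A)` is free abelian, of rank the number of classes that split into `n` classes
    Module.Free ℤ (KGroup (CrossedProduct G (MatC n))) ∧
    Module.Finite ℤ (KGroup (CrossedProduct G (MatC n))) ∧
    Module.finrank ℤ (KGroup (CrossedProduct G (MatC n))) =
      Nat.card (TildeGroup.SplitClass G n) ∧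
    -- functions of linear type on `G̃` correspond to functions on the set of these classes
    Nonempty (TildeGroup.LinearTypeFun G n ≃ₗ[ℂ] (TildeGroup.SplitClass G n → ℂ)) := by

  have hπ := TildeGroup.proj_surjective n hstar
  have : IsSemisimpleRing (CrossedProduct G (MatC n)) := CrossedProduct.isSemisimpleRing (F := ℂ)
  have : Module.Finite ℂ (CrossedProduct G (MatC n)) :=
    Module.Finite.equiv (SkewMonoidAlgebra.coeffLinearEquiv (k := MatC n) (G := G) (S := ℂ)).symm
  obtain ⟨e, he⟩ := EquivProjMod.exists_isoClass_addEquiv (G := G) (A := MatC n)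
  obtain ⟨κ⟩ := KGroup.nonempty_addEquiv_pi_int (F := ℂ) (R := CrossedProduct G (MatC n))
  obtain ⟨ζ⟩ := TildeGroup.nonempty_center_equiv_linearTypeFun hπ
  obtain ⟨ε⟩ := TildeGroup.nonempty_linearTypeFun_equiv hπ
  have hfin : Finite (TildeGroup.SplitClass G n) := Subtype.finite
  have := Fintype.ofFinite (TildeGroup.SplitClass G n)
  refine ⟨⟨Algebra.GrothendieckAddGroup.congr e, fun E M h => ?_⟩,
    Module.Free.of_equiv κ.symm.toIntLinearEquiv, Module.Finite.equiv κ.symm.toIntLinearEquiv,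
    ?_, ⟨ε⟩⟩
  · exact (Algebra.GrothendieckAddGroup.congr_of e _).trans (congrArg _ (he E M h))
  -- Rank of K(R) = dimension of the center = dimension of the functions of linear type = number of
  -- splitting classes.
  · rw [κ.toIntLinearEquiv.finrank_eq, Module.finrank_fin_fun, ζ.finrank_eq, ε.finrank_eq,
      Module.finrank_fintype_fun_eq_card, Nat.card_eq_fintype_card]
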